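/- Theorem. Let $n\in\mathbb N$ and let $G_1,\dots,G_n$ be locally compact second countable (Hausdorff) groups, each of them non-amenable and bi-exact. Let $\Gamma$ be a discrete (hence countable) subgroup of $G_1\times\cdots\times G_n$ with infinite conjugacy classes (ICC), that is, every $\gamma\in\Gamma\setminus\{e\}$ has infinitely many conjugates in $\Gamma$. Let $p_i:\Gamma\to G_i$ denote the $i$-th coordinate projection, and suppose that at least one of the following two conditions holds: 1. for every $i$, the group $p_i(\Gamma)$ contains a subgroup $\Lambda_i$ which is discrete in $G_i$ and non-amenable; 2. $\Gamma$ is irreducible, that is, $p_i(\Gamma)$ is dense in $G_i$ for every $i$. Then $\Gamma$ is not inner-amenable, that is, there is no (Radon) probability measure on $\Delta_\beta\Gamma\setminus\{e\}$ which is invariant under the extension to $\Delta_\beta\Gamma$ of the adjoint action $\mathrm{ad}(\gamma)\colon x\mapsto\gamma x\gamma^{-1}$ of $\Gamma$, where $\Delta_\beta\Gamma$ is the Stone–Čech compactification of the discrete group $\Gamma$. Here a locally compact second countable group $G$ is called bi-exact if its left action on $\nu^uG$ is topologically amenable, where $\nu^uG=h^uG\setminus G$ and $h^uG$ is the spectrum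 of the unital $C^*$-algebra $$C(h^uG)=\{f\in C_b^u(G)\;:\;\rho_gf-f\in C_0(G)\text{ for all }g\in G\};$$ here $C_b^u(G)$ is the algebra of bounded functions $f:G\to\mathbb C$ with $\|\lambda_gf-f\|_\infty\to0$ and $\|\rho_gf-f\|_\infty\to0$ as $g\to e$, with $(\lambda_gf)(x)=f(g^{-1}x)$ and $(\rho_gf)(x)=f(xg)$. An action of $G$ on a compact space $X$ is topologically amenable if there is a net of weak-$*$ continuous maps $m_j:X\to\mathrm{Prob}(G)$ such that $\|g\,m_j(x)-m_j(gx)\|\to0$ (in total variation norm), uniformly in $x\in X$ and uniformly for $g$ in compact subsets of $G$. -/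

import Mathlib

open scoped BoundedContinuousFunction Topology
open MeasureTheory Filter

noncomputable section

/-- A topological group is amenable if the bounded continuous real functions on it carry a
left-invariant mean (a positive unital linear functional). For a discrete group these are all the
bounded functions. -/
def IsAmenableGroup (G : Type*) [Group G] [TopologicalSpace G] [IsTopologicalGroup G] : Prop :=
  ∃ M : (G →ᵇ ℝ) →ₗ[ℝ] ℝ,
    (∀ f : G →ᵇ ℝ, 0 ≤ f → 0 ≤ M f) ∧ M 1 = 1 ∧
      ∀ (g : G) (f : G →ᵇ ℝ), M (f.compContinuous ⟨fun x => g * x, by fun_prop⟩) = M f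

/-- Infinite conjugacy classes: every nontrivial element has infinitely many conjugates. -/
def IsICCGroup (Γ : Type*) [Group Γ] : Prop :=
  ∀ x : Γ, x ≠ 1 → (conjugatesOf x).Infinite

/-! The Stone-Čech compactification of a discrete group is realised as the compact space of its
ultrafilters, equipped with its Borel sigma-algebra. -/

instance Ultrafilter.borelMeasurableSpace (α : Type*) : MeasurableSpace (Ultrafilter α) :=
  borel (Ultrafilter α)

instance Ultrafilter.instBorelSpace (α : Type*) : BorelSpace (Ultrafilter α) := ⟨rfl⟩

/-- A discrete group is inner-amenable if its Stone-Čech compactification without the point `1`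
carries a (regular Borel) probability measure that is invariant under the extension of the adjoint
action `x ↦ γ x γ⁻¹`. -/
def IsInnerAmenable (Γ : Type*) [Group Γ] : Prop :=
  ∃ μ : Measure (Ultrafilter Γ), IsProbabilityMeasure μ ∧ μ.Regular ∧
    μ {(pure 1 : Ultrafilter Γ)} = 0 ∧
      ∀ γ : Γ, μ.map (Ultrafilter.map fun x => γ * x * γ⁻¹) = μ

/-- Topological amenability of an action of `G` on `X`: there are weak-* continuous maps
`m : X → Prob(G)` for which `‖g • m x - m (g • x)‖` is arbitrarily small, uniformly on compact
sets of `g` and `x`. The norm is measured as the supremum over Borel sets of the difference, which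
is half the total variation norm of the difference of two probability measures. -/
def IsTopologicallyAmenableAction (G X : Type*) [Group G] [TopologicalSpace G]
    [MeasurableSpace G] [BorelSpace G] [TopologicalSpace X] [MulAction G X] : Prop :=
  ∀ ε : ℝ, 0 < ε → ∀ K : Set G, IsCompact K → ∀ L : Set X, IsCompact L →
    ∃ m : X → ProbabilityMeasure G, Continuous m ∧
      ∀ g ∈ K, ∀ x ∈ L, ∀ A : Set G, MeasurableSet A →
        |((m x : Measure G).map fun h => g * h).real A - (m (g • x) : Measure G).real A| ≤ ε

/-- `f ∈ C_0(G)`. -/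
def VanishesAtInfinity {G : Type*} [TopologicalSpace G] (f : G →ᵇ ℂ) : Prop :=
  Tendsto f (cocompact G) (𝓝 0)

theorem VanishesAtInfinity.mul_left {G : Type*} [TopologicalSpace G] {f : G →ᵇ ℂ}
    (hf : VanishesAtInfinity f) (h : G →ᵇ ℂ) :
    VanishesAtInfinity (h * f) := by
  have hf' : Tendsto (fun x => ‖h‖ * ‖f x‖) (cocompact G) (𝓝 0) := by
    simpa using (tendsto_zero_iff_norm_tendsto_zero.1 hf).const_mul ‖h‖
  refine squeeze_zero_norm (fun x => ?_) hf'
  rw [BoundedContinuousFunction.mul_apply, norm_mul]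
  exact mul_le_mul_of_nonneg_right (h.norm_coe_le_norm x) (norm_nonneg _)

theorem VanishesAtInfinity.add {G : Type*} [TopologicalSpace G] {f h : G →ᵇ ℂ}
    (hf : VanishesAtInfinity f) (hh : VanishesAtInfinity h) : VanishesAtInfinity (f + h) := by
  have := Tendsto.add hf hh
  rw [add_zero] at this
  exact this

theorem VanishesAtInfinity.star {G : Type*} [TopologicalSpace G] {f : G →ᵇ ℂ}
    (hf : VanishesAtInfinity f) :
    VanishesAtInfinity (star f) := by
  have := Tendsto.star hf
  rw [star_zero] at this
  exact this

section Compactification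

variable {G : Type*} [Group G] [TopologicalSpace G] [IsTopologicalGroup G]

/-- `(λ_g f)(x) = f (g⁻¹ x)`. -/
def leftTranslate (g : G) (f : G →ᵇ ℂ) : G →ᵇ ℂ :=
  f.compContinuous ⟨fun x => g⁻¹ * x, by fun_prop⟩

/-- `(ρ_g f)(x) = f (x g)`. -/
def rightTranslate (g : G) (f : G →ᵇ ℂ) : G →ᵇ ℂ :=
  f.compContinuous ⟨fun x => x * g, by fun_prop⟩

@[simp] theorem leftTranslate_apply (g : G) (f : G →ᵇ ℂ) (x : G) :
    leftTranslate g f x = f (g⁻¹ * x) := rfl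

@[simp] theorem rightTranslate_apply (g : G) (f : G →ᵇ ℂ) (x : G) :
    rightTranslate g f x = f (x * g) := rfl

/-- `f ∈ C_b^u(G)`: both translation orbits are norm-continuous at the identity. -/
def IsLeftRightUniform (f : G →ᵇ ℂ) : Prop :=
  Tendsto (fun g : G => ‖leftTranslate g f - f‖) (𝓝 1) (𝓝 0) ∧
    Tendsto (fun g : G => ‖rightTranslate g f - f‖) (𝓝 1) (𝓝 0)

theorem isLeftRightUniform_iff (f : G →ᵇ ℂ) : IsLeftRightUniform f ↔
    Tendsto (fun g : G => leftTranslate g f) (𝓝 1) (𝓝 f) ∧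
      Tendsto (fun g : G => rightTranslate g f) (𝓝 1) (𝓝 f) := by
  rw [IsLeftRightUniform, tendsto_iff_norm_sub_tendsto_zero (b := f),
    tendsto_iff_norm_sub_tendsto_zero (b := f)]

theorem leftTranslate_mul (g : G) (a b : G →ᵇ ℂ) : leftTranslate g (a * b) =
    leftTranslate g a * leftTranslate g b := by
  ext x
  rfl

theorem leftTranslate_add (g : G) (a b : G →ᵇ ℂ) : leftTranslate g (a + b) =
    leftTranslate g a + leftTranslate g b := by
  ext x
  rfl

theorem leftTranslate_star (g : G) (a : G →ᵇ ℂ) : leftTranslate g (star a) =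
    star (leftTranslate g a) := by
  ext x
  rfl

theorem rightTranslate_mul (g : G) (a b : G →ᵇ ℂ) : rightTranslate g (a * b) =
    rightTranslate g a * rightTranslate g b := by
  ext x
  rfl

theorem rightTranslate_add (g : G) (a b : G →ᵇ ℂ) : rightTranslate g (a + b) =
    rightTranslate g a + rightTranslate g b := by
  ext x
  rfl

theorem rightTranslate_star (g : G) (a : G →ᵇ ℂ) : rightTranslate g (star a) =
    star (rightTranslate g a) := by
  ext x
  rfl

theorem isLeftRightUniform_mul {a b : G →ᵇ ℂ} (ha : IsLeftRightUniform a)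
    (hb : IsLeftRightUniform b) : IsLeftRightUniform (a * b) := by
  rw [isLeftRightUniform_iff] at ha hb ⊢
  simp only [leftTranslate_mul, rightTranslate_mul]
  exact ⟨ha.1.mul hb.1, ha.2.mul hb.2⟩

theorem isLeftRightUniform_add {a b : G →ᵇ ℂ} (ha : IsLeftRightUniform a)
    (hb : IsLeftRightUniform b) : IsLeftRightUniform (a + b) := by
  rw [isLeftRightUniform_iff] at ha hb ⊢
  simp only [leftTranslate_add, rightTranslate_add]
  exact ⟨ha.1.add hb.1, ha.2.add hb.2⟩

theorem isLeftRightUniform_star {a : G →ᵇ ℂ} (ha : IsLeftRightUniform a) :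
    IsLeftRightUniform (star a) := by
  rw [isLeftRightUniform_iff] at ha ⊢
  simp only [leftTranslate_star, rightTranslate_star]
  exact ⟨ha.1.star, ha.2.star⟩

theorem isLeftRightUniform_algebraMap (c : ℂ) :
    IsLeftRightUniform (algebraMap ℂ (G →ᵇ ℂ) c) := by
  rw [isLeftRightUniform_iff]
  exact ⟨tendsto_const_nhds, tendsto_const_nhds⟩

variable (G) in
/-- The unital C*-algebra `C(h^u G)` of all `f ∈ C_b^u(G)` with `ρ_g f - f ∈ C_0(G)` for all
`g`. -/
def smallAtInfinityAlgebra : StarSubalgebra ℂ (G →ᵇ ℂ) where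
  carrier := {f | IsLeftRightUniform f ∧ ∀ g : G, VanishesAtInfinity (rightTranslate g f - f)}
  mul_mem' := by
    rintro a b ⟨ha, ha'⟩ ⟨hb, hb'⟩
    refine ⟨isLeftRightUniform_mul ha hb, fun g => ?_⟩
    have h : rightTranslate g (a * b) - a * b =
        rightTranslate g a * (rightTranslate g b - b) + b * (rightTranslate g a - a) := by
      ext x
      change a (x * g) * b (x * g) - a x * b x =
        a (x * g) * (b (x * g) - b x) + b x * (a (x * g) - a x)
      ring
    rw [h]
    exact ((hb' g).mul_left _).add ((ha' g).mul_left b)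
  add_mem' := by
    rintro a b ⟨ha, ha'⟩ ⟨hb, hb'⟩
    refine ⟨isLeftRightUniform_add ha hb, fun g => ?_⟩
    have h : rightTranslate g (a + b) - (a + b) =
        (rightTranslate g a - a) + (rightTranslate g b - b) := by
      rw [rightTranslate_add, add_sub_add_comm]
    rw [h]
    exact (ha' g).add (hb' g)
  algebraMap_mem' := by
    intro c
    refine ⟨isLeftRightUniform_algebraMap c, fun g => ?_⟩
    have h : (rightTranslate g (algebraMap ℂ (G →ᵇ ℂ) c) - algebraMap ℂ (G →ᵇ ℂ) c) = 0 :=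
      sub_self _
    rw [h]
    exact tendsto_const_nhds
  star_mem' := by
    rintro a ⟨ha, ha'⟩
    refine ⟨isLeftRightUniform_star ha, fun g => ?_⟩
    have h : rightTranslate g (star a) - star a = star (rightTranslate g a - a) := by
      rw [rightTranslate_star, star_sub]
    rw [h]
    exact (ha' g).star

theorem leftTranslate_mem (g : G) {f : G →ᵇ ℂ} (hf : f ∈ smallAtInfinityAlgebra G) :
    leftTranslate g f ∈ smallAtInfinityAlgebra G := by
  obtain ⟨hu, h0⟩ := hf
  have hcont : Continuous (leftTranslate g) :=
    BoundedContinuousFunction.continuous_compContinuous _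
  rw [isLeftRightUniform_iff] at hu
  refine ⟨(isLeftRightUniform_iff _).2 ⟨?_, ?_⟩, fun k => ?_⟩
  · have hconj : Tendsto (fun k : G => g⁻¹ * k * g) (𝓝 1) (𝓝 1) := by
      have : Continuous fun k : G => g⁻¹ * k * g := by fun_prop
      simpa using this.tendsto 1
    refine ((hcont.tendsto f).comp (hu.1.comp hconj)).congr fun k => ?_
    ext x
    simp [mul_assoc]
  · refine ((hcont.tendsto f).comp hu.2).congr fun k => ?_
    ext x
    simp [mul_assoc]
  · have hinf : Tendsto (fun x : G => g⁻¹ * x) (cocompact G) (cocompact G) :=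
      (Homeomorph.mulLeft g⁻¹).isClosedEmbedding.tendsto_cocompact
    refine ((h0 k).comp hinf).congr fun x => ?_
    simp [mul_assoc]

variable (G) in
/-- The compactification `h^u G`: the Gelfand spectrum of `C(h^u G)`. -/
abbrev SmallAtInfinityCompactification : Type _ :=
  WeakDual.characterSpace ℂ (smallAtInfinityAlgebra G)

/-- The canonical map `G → h^u G`: evaluation at a point. -/
def evalCharacter (x : G) : SmallAtInfinityCompactification G :=
  ⟨((BoundedContinuousFunction.evalCLM ℂ x).comp
      (smallAtInfinityAlgebra G).toSubalgebra.toSubmodule.subtypeL :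
      smallAtInfinityAlgebra G →L[ℂ] ℂ), by
    rw [WeakDual.CharacterSpace.eq_set_map_one_map_mul]
    exact ⟨rfl, fun _ _ => rfl⟩⟩

/-- Left translation by `g` on `C(h^u G)`. -/
def leftTranslateCLM (g : G) : smallAtInfinityAlgebra G →L[ℂ] smallAtInfinityAlgebra G where
  toFun f := ⟨leftTranslate g f, leftTranslate_mem g f.2⟩
  map_add' _ _ := rfl
  map_smul' _ _ := rfl
  cont := Continuous.subtype_mk
    ((BoundedContinuousFunction.continuous_compContinuous _).comp continuous_subtype_val) _

/-- The extension to `h^u G` of the left action of `G` on itself: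
`(g • χ)(f) = χ (λ_{g⁻¹} f)`. -/
instance SmallAtInfinityCompactification.instMulAction :
    MulAction G (SmallAtInfinityCompactification G) where
  smul g χ := ⟨((WeakDual.CharacterSpace.toCLM χ).comp (leftTranslateCLM g⁻¹) :
      smallAtInfinityAlgebra G →L[ℂ] ℂ), by
    rw [WeakDual.CharacterSpace.eq_set_map_one_map_mul]
    exact ⟨map_one χ, fun a b => map_mul χ (leftTranslateCLM g⁻¹ a) (leftTranslateCLM g⁻¹ b)⟩⟩
  one_smul χ := by
    ext f
    change χ (leftTranslateCLM 1⁻¹ f) = χ f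
    congr 1
    ext x
    change (f : G →ᵇ ℂ) (1⁻¹⁻¹ * x) = (f : G →ᵇ ℂ) x
    simp
  mul_smul g h χ := by
    ext f
    change χ (leftTranslateCLM (g * h)⁻¹ f) = χ (leftTranslateCLM h⁻¹ (leftTranslateCLM g⁻¹ f))
    congr 1
    ext x
    change (f : G →ᵇ ℂ) ((g * h)⁻¹⁻¹ * x) = (f : G →ᵇ ℂ) (g⁻¹⁻¹ * (h⁻¹⁻¹ * x))
    simp [mul_assoc]

theorem smul_character_apply (g : G) (χ : SmallAtInfinityCompactification G)
    (f : smallAtInfinityAlgebra G) : (g • χ) f = χ (leftTranslateCLM g⁻¹ f) := rfl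

theorem smul_evalCharacter (g x : G) : g • evalCharacter x = evalCharacter (g * x) := by
  ext f
  change (f : G →ᵇ ℂ) (g⁻¹⁻¹ * x) = (f : G →ᵇ ℂ) (g * x)
  rw [inv_inv]

variable (G) in
/-- The boundary `ν^u G = h^u G \ G`, as a `G`-invariant set. -/
def smallAtInfinityBoundary : SubMulAction G (SmallAtInfinityCompactification G) where
  carrier := {χ | ∀ x : G, χ ≠ evalCharacter x}
  smul_mem' g χ hχ x h := hχ (g⁻¹ * x) (by rw [← smul_evalCharacter, ← h, inv_smul_smul])

end Compactification

/-- A locally compact group is bi-exact if its left action on the boundary `ν^u G` is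
topologically amenable. -/
def IsBiExact (G : Type*) [Group G] [TopologicalSpace G] [IsTopologicalGroup G]
    [MeasurableSpace G] [BorelSpace G] : Prop :=
  IsTopologicallyAmenableAction G (smallAtInfinityBoundary G)

end

/-!
Let `μ` be a conjugation invariant probability measure on `βΓ`, realised as the space of
ultrafilters, with `μ {1} = 0`. Since `Γ` is ICC, `μ` charges no point of `Γ`
(`measure_singleton_pure_eq_zero`). Since `Γ` is discrete in the product, every nonprincipal
ultrafilter tends to infinity in some factor (`exists_mem_ultrafiltersToInfinity`), so for some `i`
the closed invariant set `X` of ultrafilters tending to infinity along `p_i : Γ → G_i` has positive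
measure.

The extension `φ : βΓ → h^u G_i` of `p_i` maps `X` into the boundary `ν^u G_i`, because
`C_c(G_i) ⊆ C(h^u G_i)`. Functions in `C(h^u G_i)` are right invariant modulo `C_0(G_i)`, so on `X`
conjugation by `γ` becomes left translation by `p_i γ` (`ultrafilterLimit_adUltrafilter`).
Bi-exactness gives almost equivariant maps `m : ν^u G_i → Prob(G_i)`, and averaging `m ∘ φ` over
`μ` restricted to `X` gives probability measures on `G_i` that are almost invariant under `p_i(Γ)`, uniformly on
compact sets (`exists_almost_invariant_of_isBiExact`).

If `p_i(Γ)` is dense, continuity of translation makes the measures almost invariant under all of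
`G_i`, which is then amenable (`isAmenableGroup_of_dense`). If `p_i(Γ)` contains a discrete subgroup
`Λ`, an equivariant Borel map `G_i → Λ` carries them to `Λ`, which is then amenable
(`isAmenableGroup_of_discrete`). Either conclusion contradicts the hypotheses.
-/

noncomputable section

/-! ### Almost invariant probability measures and amenability -/

/-- Two probability measures that differ by at most `ε` on every measurable set have integrals of
a bounded measurable function that differ by at most `2 ε` times the bound (layer cake formula). -/
theorem abs_integral_sub_le_of_abs_measureReal_sub_le {X : Type*} [MeasurableSpace X]
    {μ ν : Measure X} [IsProbabilityMeasure μ] [IsProbabilityMeasure ν] {ε : ℝ}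
    (h : ∀ A, MeasurableSet A → |μ.real A - ν.real A| ≤ ε) {f : X → ℝ} (hf : Measurable f)
    {C : ℝ} (hC : ∀ x, |f x| ≤ C) : |∫ x, f x ∂μ - ∫ x, f x ∂ν| ≤ 2 * ε * C := by
  obtain ⟨x₀⟩ : Nonempty X := nonempty_of_isProbabilityMeasure μ
  -- the layer cake formula applies to `f + C`, which takes values in `[0, 2 C]`
  have hC0 : 0 ≤ C := (abs_nonneg _).trans (hC x₀)
  have hint : ∀ ρ : Measure X, IsProbabilityMeasure ρ → Integrable f ρ := fun ρ _ =>
    Integrable.of_bound hf.aestronglyMeasurable C (Eventually.of_forall hC)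
  have hshift : ∀ ρ : Measure X, IsProbabilityMeasure ρ →
      ∫ x, f x ∂ρ + C = ∫ t in Set.Ioc 0 (2 * C), ρ.real {a | t ≤ f a + C} := by
    intro ρ _
    rw [← Integrable.integral_eq_integral_Ioc_meas_le (f := fun a => f a + C)
      ((hint ρ inferInstance).add (integrable_const C))]
    · rw [integral_add (hint ρ inferInstance) (integrable_const C)]
      simp
    · exact Eventually.of_forall fun x => by
        have := (abs_le.1 (hC x)).1
        simp only [Pi.zero_apply]; linarith
    · exact Eventually.of_forall fun x => by
        have := (abs_le.1 (hC x)).2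
        simp only; linarith
  have hanti : ∀ ρ : Measure X, IsProbabilityMeasure ρ →
      IntegrableOn (fun t : ℝ => ρ.real {a | t ≤ f a + C}) (Set.Ioc 0 (2 * C)) := by
    intro ρ _
    have hA : Antitone fun t : ℝ => ρ.real {a | t ≤ f a + C} := fun s t hst =>
      measureReal_mono (fun a (ha : t ≤ f a + C) => hst.trans ha)
    exact Integrable.of_bound hA.measurable.aestronglyMeasurable 1 (Eventually.of_forall fun t => by
      rw [Real.norm_of_nonneg measureReal_nonneg]; exact measureReal_le_one)
  have key : ∫ x, f x ∂μ - ∫ x, f x ∂ν =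
      ∫ t in Set.Ioc 0 (2 * C), (μ.real {a | t ≤ f a + C} - ν.real {a | t ≤ f a + C}) := by
    rw [integral_sub (hanti μ inferInstance) (hanti ν inferInstance), ← hshift μ inferInstance,
      ← hshift ν inferInstance]
    ring
  rw [key, ← Real.norm_eq_abs]
  refine (norm_setIntegral_le_of_norm_le_const (C := ε) measure_Ioc_lt_top fun t _ =>
    h _ (measurableSet_le measurable_const (hf.add_const C))).trans_eq ?_
  rw [Measure.real, Real.volume_Ioc, ENNReal.toReal_ofReal (by linarith)]
  ring

/-- A group that carries, for every finite set of its elements, probability measures that are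
almost invariant under these elements is amenable: an ultralimit of the measures is an invariant
mean. -/
theorem isAmenableGroup_of_almost_invariant {H : Type*} [Group H] [TopologicalSpace H]
    [IsTopologicalGroup H] [MeasurableSpace H] [BorelSpace H]
    (h : ∀ ε : ℝ, 0 < ε → ∀ F : Finset H, ∃ ν : Measure H, IsProbabilityMeasure ν ∧
      ∀ g ∈ F, ∀ f : H →ᵇ ℝ, |∫ x, f (g * x) ∂ν - ∫ x, f x ∂ν| ≤ ε * ‖f‖) :
    IsAmenableGroup H := by
  classical
  -- indexing by pairs makes the error tend to `0` even if `H` is finite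
  choose ν hν hinv using fun i : ℕ × Finset H => h (1 / ((i.1 : ℝ) + 1)) (by positivity) i.2
  have hint : ∀ (f : H →ᵇ ℝ) i, Integrable f (ν i) := fun f i =>
    BoundedContinuousFunction.integrable _ f
  obtain ⟨U, hU⟩ : ∃ U : Ultrafilter (ℕ × Finset H), (U : Filter (ℕ × Finset H)) ≤ atTop :=
    Ultrafilter.exists_le _
  have hlim : ∀ f : H →ᵇ ℝ, ∃ l, Tendsto (fun i => ∫ x, f x ∂ν i) U (𝓝 l) := by
    intro f
    obtain ⟨l, -, hl⟩ := (isCompact_Icc (a := -‖f‖) (b := ‖f‖)).ultrafilter_le_nhds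
      (U.map fun i => ∫ x, f x ∂ν i) (by
        refine le_principal_iff.2 (Ultrafilter.mem_map.2 (univ_mem' fun i => ?_))
        have := BoundedContinuousFunction.norm_integral_le_norm (ν i) f
        rwa [Real.norm_eq_abs, abs_le] at this)
    exact ⟨l, hl⟩
  choose M hM using hlim
  refine ⟨{ toFun := M, map_add' := fun f g => ?_, map_smul' := fun c f => ?_ },
    fun f hf => ?_, ?_, fun g f => ?_⟩
  · refine tendsto_nhds_unique (hM (f + g)) (((hM f).add (hM g)).congr fun i => ?_)
    exact (integral_add (hint f i) (hint g i)).symm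
  · refine tendsto_nhds_unique (hM (c • f)) (((hM f).const_smul c).congr fun i => ?_)
    exact (integral_smul c f).symm
  · exact ge_of_tendsto (hM f) (Eventually.of_forall fun i => integral_nonneg hf)
  · refine tendsto_nhds_unique (hM 1) (tendsto_const_nhds.congr fun i => ?_)
    simp
  · set f' : H →ᵇ ℝ := f.compContinuous ⟨fun x => g * x, by fun_prop⟩ with hf'
    refine sub_eq_zero.1 (tendsto_nhds_unique ((hM f').sub (hM f)) ?_)
    have h0 : Tendsto (fun i : ℕ × Finset H => 1 / ((i.1 : ℝ) + 1) * ‖f‖) atTop (𝓝 0) := by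
      have := (tendsto_one_div_add_atTop_nhds_zero_nat (𝕜 := ℝ)).mul_const ‖f‖
      rw [zero_mul] at this
      rw [← prod_atTop_atTop_eq]
      exact this.comp tendsto_fst
    refine squeeze_zero_norm' ?_ (h0.mono_left hU)
    filter_upwards [hU (eventually_ge_atTop (0, {g}))] with i hi
    exact hinv i g (hi.2 (Finset.mem_singleton_self g)) f

/-- Averaging an almost equivariant family of probability measures over an invariant probability
measure gives an almost invariant probability measure. -/
theorem abs_measureReal_map_bind_sub_le {X G : Type*} [MeasurableSpace X] [MeasurableSpace G]
    {ν : Measure X} [IsProbabilityMeasure ν] {κ : X → Measure G} (hκ : Measurable κ)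
    [∀ x, IsProbabilityMeasure (κ x)] {T : X → X} (hT : MeasurePreserving T ν ν) {S : G → G}
    (hS : Measurable S) {ε : ℝ}
    (h : ∀ x A, MeasurableSet A → |((κ x).map S).real A - (κ (T x)).real A| ≤ ε)
    {A : Set G} (hA : MeasurableSet A) :
    |((ν.bind κ).map S).real A - (ν.bind κ).real A| ≤ ε := by
  have hmeas : ∀ B : Set G, MeasurableSet B → Measurable fun x => κ x B := fun B hB =>
    (Measure.measurable_coe hB).comp hκ
  have hreal : ∀ B : Set G, MeasurableSet B → (ν.bind κ).real B = ∫ x, (κ x).real B ∂ν := by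
    intro B hB
    rw [Measure.real, Measure.bind_apply hB hκ.aemeasurable,
      ← integral_toReal (hmeas B hB).aemeasurable
        (Eventually.of_forall fun x => measure_lt_top _ _)]
    rfl
  have hint : ∀ B : Set G, MeasurableSet B → ∀ R : X → X, Measurable R →
      Integrable (fun x => (κ (R x)).real B) ν := by
    intro B hB R hR
    refine Integrable.of_bound ((hmeas B hB).comp hR).ennreal_toReal.aestronglyMeasurable 1
      (Eventually.of_forall fun x => ?_)
    rw [Real.norm_of_nonneg measureReal_nonneg]
    exact measureReal_le_one
  have hTint : (ν.bind κ).real A = ∫ x, (κ (T x)).real A ∂ν := by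
    rw [hreal A hA]
    nth_rewrite 1 [← hT.map_eq]
    exact integral_map hT.measurable.aemeasurable
      (hmeas A hA).ennreal_toReal.aestronglyMeasurable
  -- invariance of `ν` replaces `κ x` by `κ (T x)` in the second integral
  rw [map_measureReal_apply hS hA, hreal _ (hS hA), hTint,
    ← integral_sub (hint _ (hS hA) (fun x => x) measurable_id) (hint A hA T hT.measurable),
    ← Real.norm_eq_abs]
  refine (norm_integral_le_of_norm_le_const (C := ε) (Eventually.of_forall fun x => ?_)).trans_eq
    (by simp)
  have := h x A hA
  rwa [map_measureReal_apply hS hA] at this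

/-- A weak-* continuous family of probability measures is measurable: the mass of an open set
depends lower semicontinuously on the measure, and the open sets form a generating π-system. -/
theorem measurable_coe_of_continuous_probabilityMeasure {X G : Type*} [TopologicalSpace X]
    [MeasurableSpace X] [OpensMeasurableSpace X] [TopologicalSpace G] [MeasurableSpace G]
    [BorelSpace G] [HasOuterApproxClosed G] {κ : X → ProbabilityMeasure G} (hκ : Continuous κ) :
    Measurable fun x => (κ x : Measure G) := by
  refine Measurable.measure_of_isPiSystem_of_isProbabilityMeasure
    (BorelSpace.measurable_eq (α := G)) isPiSystem_isOpen fun s hs => ?_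
  have : LowerSemicontinuous fun x => (κ x : Measure G) s := fun x =>
    lowerSemicontinuousAt_iff_le_liminf.2
      (ProbabilityMeasure.le_liminf_measure_open_of_tendsto (hκ.tendsto x) hs)
  exact this.measurable

/-! ### Equivariant Borel maps onto discrete subgroups -/

/-- A discrete subgroup `Λ` of a second countable group has a Borel fundamental domain; this is
recorded as a Borel map `c` to `Λ` that commutes with left multiplication by `Λ`. The group is
covered by countably many translates `U g k` of a neighbourhood `U` of `1` with
`U U⁻¹ ∩ Λ = {1}`, and `c x = l` when `x ∈ l U g k` for the first `k` with `x ∈ Λ U g k`. -/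
theorem exists_measurable_equivariant_of_discrete {G : Type*} [Group G] [TopologicalSpace G]
    [IsTopologicalGroup G] [SecondCountableTopology G] [MeasurableSpace G] [BorelSpace G]
    (Λ : Subgroup G) [DiscreteTopology Λ] :
    ∃ c : G → Λ, Measurable c ∧ ∀ (l : Λ) (x : G), c (l * x) = l * c x := by
  classical
  obtain ⟨W, hW, hW1⟩ : ∃ W : Set G, IsOpen W ∧ ∀ l : Λ, (l : G) ∈ W ↔ l = 1 := by
    obtain ⟨W, hW, hWe⟩ := isOpen_induced_iff.1 (isOpen_discrete ({1} : Set Λ))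
    exact ⟨W, hW, fun l => by rw [← Set.mem_singleton_iff, ← hWe]; rfl⟩
  obtain ⟨U, hU, hU1, hUW⟩ : ∃ U : Set G, IsOpen U ∧ 1 ∈ U ∧ ∀ u ∈ U, ∀ v ∈ U, u * v⁻¹ ∈ W := by
    have hc : Continuous fun p : G × G => p.1 * p.2⁻¹ := by fun_prop
    have h1 : W ∈ 𝓝 ((1 : G) * (1 : G)⁻¹) := hW.mem_nhds (by simpa using (hW1 1).2 rfl)
    have h2 := hc.continuousAt (x := ((1 : G), (1 : G))) h1
    rw [mem_map, nhds_prod_eq, mem_prod_same_iff] at h2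
    obtain ⟨t, ht, hts⟩ := h2
    obtain ⟨U, hUt, hU, hU1⟩ := mem_nhds_iff.1 ht
    exact ⟨U, hU, hU1, fun u hu v hv => hts (Set.mk_mem_prod (hUt hu) (hUt hv))⟩
  obtain ⟨S, hS, hcover⟩ := TopologicalSpace.isOpen_iUnion_countable
    (fun g : G => (fun x => x * g⁻¹) ⁻¹' U) fun g => hU.preimage (by fun_prop)
  have hcov : ∀ x : G, ∃ g ∈ S, x * g⁻¹ ∈ U := by
    intro x
    have : x ∈ ⋃ g : G, (fun x => x * g⁻¹) ⁻¹' U := Set.mem_iUnion.2 ⟨x, by simpa using hU1⟩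
    rw [← hcover] at this
    simpa using this
  have hSne : S.Nonempty := let ⟨g, hg, _⟩ := hcov 1; ⟨g, hg⟩
  obtain ⟨g, rfl⟩ := hS.exists_eq_range hSne
  -- `x ∈ l U (g k)`
  let P : ℕ → Λ → G → Prop := fun k l x => (l : G)⁻¹ * x * (g k)⁻¹ ∈ U
  have hPopen : ∀ k l, IsOpen {x | P k l x} := fun k l =>
    hU.preimage (f := fun x => (l : G)⁻¹ * x * (g k)⁻¹) (by fun_prop)
  have hPmul : ∀ k (l l' : Λ) x, P k (l * l') (l * x) ↔ P k l' x := fun k l l' x => by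
    simp [P, mul_assoc]
  have hPuniq : ∀ k (l l' : Λ) x, P k l x → P k l' x → l = l' := by
    intro k l l' x h h'
    have := hUW _ h _ h'
    have he : (l : G)⁻¹ * x * (g k)⁻¹ * ((l' : G)⁻¹ * x * (g k)⁻¹)⁻¹ = ((l⁻¹ * l' : Λ) : G) := by
      push_cast; group
    rw [he, hW1] at this
    exact inv_mul_eq_one.1 this
  have hex : ∀ x : G, ∃ k, ∃ l, P k l x := by
    intro x
    obtain ⟨_, ⟨k, rfl⟩, hk⟩ := hcov x
    exact ⟨k, 1, by simpa [P] using hk⟩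
  have hspec : ∀ x, ∃ l, P (Nat.find (hex x)) l x := fun x => Nat.find_spec (hex x)
  choose c hc using hspec
  have hiff : ∀ x l, c x = l ↔ ∃ k, P k l x ∧ ∀ j < k, ¬ ∃ l', P j l' x := by
    intro x l
    constructor
    · rintro rfl
      exact ⟨_, hc x, fun j hj => Nat.find_min (hex x) hj⟩
    · rintro ⟨k, hk, hmin⟩
      have hk' : Nat.find (hex x) = k := (Nat.find_eq_iff _).2 ⟨⟨l, hk⟩, hmin⟩
      exact hPuniq k _ _ x (hk' ▸ hc x) hk
  have : Countable Λ := TopologicalSpace.separableSpace_iff_countable.1 inferInstance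
  refine ⟨c, measurable_to_countable' fun l => ?_, fun l x => (hiff _ _).2 ?_⟩
  · have : c ⁻¹' {l} = ⋃ k, {x | P k l x} ∩ ⋂ j, ⋂ (_ : j < k), (⋃ l', {x | P j l' x})ᶜ := by
      ext x
      rw [Set.mem_preimage, Set.mem_singleton_iff, hiff]
      simp
    rw [this]
    exact MeasurableSet.iUnion fun k => (hPopen k l).measurableSet.inter <|
      MeasurableSet.iInter fun j => MeasurableSet.iInter fun _ =>
        (isOpen_iUnion fun l' => hPopen j l').measurableSet.compl
  · refine ⟨Nat.find (hex x), (hPmul _ _ _ _).2 (hc x), fun j hj ⟨l', hl'⟩ => ?_⟩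
    refine Nat.find_min (hex x) hj ⟨l⁻¹ * l', ?_⟩
    rw [← hPmul j l]
    simpa using hl'

/-! ### The small-at-infinity compactification -/

theorem VanishesAtInfinity.sub {G : Type*} [TopologicalSpace G] {f h : G →ᵇ ℂ}
    (hf : VanishesAtInfinity f) (hh : VanishesAtInfinity h) : VanishesAtInfinity (f - h) := by
  have := Tendsto.sub hf hh
  rw [sub_zero] at this
  exact this

theorem isClosed_setOf_vanishesAtInfinity {G : Type*} [TopologicalSpace G] :
    IsClosed {f : G →ᵇ ℂ | VanishesAtInfinity f} := by
  refine isClosed_of_closure_subset fun f hf => ?_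
  refine Metric.tendsto_nhds.2 fun ε hε => ?_
  obtain ⟨h, hh, hfh⟩ := Metric.mem_closure_iff.1 hf (ε / 2) (half_pos hε)
  filter_upwards [Metric.tendsto_nhds.1 hh (ε / 2) (half_pos hε)] with x hx
  calc dist (f x) 0 ≤ dist (f x) (h x) + dist (h x) 0 := dist_triangle _ _ _
    _ < ε / 2 + ε / 2 := add_lt_add (lt_of_le_of_lt (BoundedContinuousFunction.dist_coe_le_dist x)
      hfh) hx
    _ = ε := add_halves ε

/-- For a family of additive contractions, the elements with continuous orbits are closed. -/
theorem isClosed_setOf_tendsto_norm_sub {ι E : Type*} [SeminormedAddCommGroup E] {l : Filter ι}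
    (T : ι → E → E) (hsub : ∀ i a b, T i (a - b) = T i a - T i b) (hT : ∀ i a, ‖T i a‖ ≤ ‖a‖) :
    IsClosed {f : E | Tendsto (fun i => ‖T i f - f‖) l (𝓝 0)} := by
  refine isClosed_of_closure_subset fun f hf => ?_
  refine Metric.tendsto_nhds.2 fun ε hε => ?_
  obtain ⟨h, hh, hfh⟩ := Metric.mem_closure_iff.1 hf (ε / 3) (by positivity)
  filter_upwards [Metric.tendsto_nhds.1 hh (ε / 3) (by positivity)] with i hi
  rw [dist_zero_right, norm_norm] at hi ⊢
  rw [dist_eq_norm] at hfh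
  have he : T i f - f = T i (f - h) + (T i h - h) - (f - h) := by rw [hsub]; abel
  calc ‖T i f - f‖ ≤ ‖T i (f - h)‖ + ‖T i h - h‖ + ‖f - h‖ := by
        rw [he]; exact (norm_sub_le _ _).trans (add_le_add_left (norm_add_le _ _) _)
    _ < ε := by linarith [hT i (f - h)]

/-- A continuous deformation of the identity, trivial outside a compact set `C` where `f` lives,
moves `f` uniformly little. -/
theorem tendsto_norm_sub_of_eq_zero_off_compact {ι X : Type*} [TopologicalSpace ι]
    [TopologicalSpace X] {e : ι} {f : X →ᵇ ℂ} {T : ι → X → X}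
    (hT : Continuous fun q : ι × X => T q.1 q.2)
    (hT1 : ∀ x, T e x = x) {C : Set X} (hC : IsCompact C)
    (h0 : ∀ᶠ g in 𝓝 e, ∀ x ∉ C, f (T g x) = 0 ∧ f x = 0)
    (F : ι → X →ᵇ ℂ) (hF : ∀ g x, F g x = f (T g x)) :
    Tendsto (fun g => ‖F g - f‖) (𝓝 e) (𝓝 0) := by
  refine Metric.tendsto_nhds.2 fun ε hε => ?_
  have hev : ∀ᶠ g in 𝓝 e, ∀ x ∈ C, ‖f (T g x) - f x‖ < ε / 2 := by
    refine hC.eventually_forall_of_forall_eventually fun x _ => ?_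
    have hcont : Continuous fun q : ι × X => ‖f (T q.1 q.2) - f q.2‖ :=
      ((f.continuous.comp hT).sub (f.continuous.comp continuous_snd)).norm
    refine hcont.continuousAt.eventually_lt continuousAt_const ?_
    simpa [hT1] using hε
  filter_upwards [hev, h0] with g hg hg0
  rw [dist_zero_right, norm_norm]
  refine lt_of_le_of_lt ((BoundedContinuousFunction.norm_le (half_pos hε).le).2 fun x => ?_)
    (half_lt_self hε)
  rw [BoundedContinuousFunction.sub_apply, hF]
  by_cases hx : x ∈ C
  · exact (hg x hx).le
  · rw [(hg0 x hx).1, (hg0 x hx).2, sub_self, norm_zero]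
    exact (half_pos hε).le

section Algebra

variable {G : Type*} [Group G] [TopologicalSpace G] [IsTopologicalGroup G]

theorem continuous_rightTranslate (g : G) : Continuous (rightTranslate g : (G →ᵇ ℂ) → G →ᵇ ℂ) :=
  BoundedContinuousFunction.continuous_compContinuous _

theorem norm_leftTranslate_le (g : G) (f : G →ᵇ ℂ) : ‖leftTranslate g f‖ ≤ ‖f‖ :=
  (BoundedContinuousFunction.norm_le (norm_nonneg f)).2 fun x => f.norm_coe_le_norm (g⁻¹ * x)

theorem norm_rightTranslate_le (g : G) (f : G →ᵇ ℂ) : ‖rightTranslate g f‖ ≤ ‖f‖ :=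
  (BoundedContinuousFunction.norm_le (norm_nonneg f)).2 fun x => f.norm_coe_le_norm (x * g)

theorem isClosed_smallAtInfinityAlgebra :
    IsClosed (smallAtInfinityAlgebra G : Set (G →ᵇ ℂ)) := by
  have : (smallAtInfinityAlgebra G : Set (G →ᵇ ℂ)) =
      ({f | Tendsto (fun g : G => ‖leftTranslate g f - f‖) (𝓝 1) (𝓝 0)} ∩
        {f | Tendsto (fun g : G => ‖rightTranslate g f - f‖) (𝓝 1) (𝓝 0)}) ∩
      ⋂ g : G, (fun f => rightTranslate g f - f) ⁻¹' {f | VanishesAtInfinity f} := by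
    ext f
    simp only [Set.mem_inter_iff, Set.mem_iInter]
    rfl
  rw [this]
  exact ((isClosed_setOf_tendsto_norm_sub _ (fun _ _ _ => rfl) norm_leftTranslate_le).inter
    (isClosed_setOf_tendsto_norm_sub _ (fun _ _ _ => rfl) norm_rightTranslate_le)).inter
    (isClosed_iInter fun g => isClosed_setOf_vanishesAtInfinity.preimage
      ((continuous_rightTranslate g).sub continuous_id))

/-- Completeness makes the character space `h^u G` compact. -/
instance : CompleteSpace (smallAtInfinityAlgebra G) :=
  isClosed_smallAtInfinityAlgebra.completeSpace_coe

/-- `C_c(G) ⊆ C(h^u G)`. -/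
theorem mem_smallAtInfinityAlgebra_of_hasCompactSupport [LocallyCompactSpace G] {f : G →ᵇ ℂ}
    (hf : HasCompactSupport f) : f ∈ smallAtInfinityAlgebra G := by
  obtain ⟨V, hV, hV1⟩ := exists_compact_mem_nhds (1 : G)
  have hf' : IsCompact (tsupport f) := hf
  have hz : ∀ {x}, x ∉ tsupport f → f x = 0 := fun h => image_eq_zero_of_notMem_tsupport h
  refine ⟨⟨?_, ?_⟩, fun g => ?_⟩
  · refine tendsto_norm_sub_of_eq_zero_off_compact (T := fun g x => g⁻¹ * x) (by fun_prop)
      (by simp) ((hV.mul hf').union hf') ?_ _ fun _ _ => rfl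
    filter_upwards [hV1] with g hg x hx
    rw [Set.mem_union, not_or] at hx
    exact ⟨hz fun h => hx.1 ⟨g, hg, _, h, mul_inv_cancel_left g x⟩, hz hx.2⟩
  · refine tendsto_norm_sub_of_eq_zero_off_compact (T := fun g x => x * g) (by fun_prop)
      (by simp) ((hf'.mul hV.inv).union hf') ?_ _ fun _ _ => rfl
    filter_upwards [hV1] with g hg x hx
    rw [Set.mem_union, not_or] at hx
    exact ⟨hz fun h => hx.1 ⟨_, h, g⁻¹, by simpa using hg, mul_inv_cancel_right x g⟩, hz hx.2⟩
  · have h0 : VanishesAtInfinity f := hf.is_zero_at_infty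
    exact VanishesAtInfinity.sub
      (h0.comp (Homeomorph.mulRight g).isClosedEmbedding.tendsto_cocompact) h0

/-- The evaluation at `x` is nonzero on `C_0(G) ∩ C(h^u G)`, which is what separates it from the
characters that are limits at infinity. -/
theorem exists_mem_smallAtInfinityAlgebra_apply_ne_zero [LocallyCompactSpace G] (x : G) :
    ∃ f ∈ smallAtInfinityAlgebra G, f x ≠ 0 ∧ VanishesAtInfinity f := by
  obtain ⟨h, h1, -, hc, hI⟩ := exists_continuous_one_zero_of_isCompact
    (isCompact_singleton (x := x)) isClosed_empty (Set.disjoint_empty _)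
  let f : G →ᵇ ℂ := BoundedContinuousFunction.ofNormedAddCommGroup (fun y => (h y : ℂ))
    (by fun_prop) 1 fun y => by
      rw [Complex.norm_real, Real.norm_of_nonneg (hI y).1]; exact (hI y).2
  have hf : HasCompactSupport f := hc.comp_left (g := fun r : ℝ => (r : ℂ)) Complex.ofReal_zero
  refine ⟨f, mem_smallAtInfinityAlgebra_of_hasCompactSupport hf, ?_, hf.is_zero_at_infty⟩
  have : h x = 1 := h1 rfl
  change (h x : ℂ) ≠ 0
  simp [this]

end Algebra

/-! ### Boundary points attached to ultrafilters -/

section Ultrafilters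

variable {G Γ : Type*} [Group G] [TopologicalSpace G] [Group Γ] (p : Γ →* G)

/-- The ultrafilters on `Γ` along which the homomorphism `p : Γ → G` tends to infinity. -/
def ultrafiltersToInfinity : Set (Ultrafilter Γ) :=
  {ω | Tendsto p ω (cocompact G)}

theorem isClosed_ultrafiltersToInfinity : IsClosed (ultrafiltersToInfinity p) := by
  have : ultrafiltersToInfinity p =
      ⋂ (K : Set G) (_ : IsCompact K), {ω : Ultrafilter Γ | p ⁻¹' Kᶜ ∈ ω} := by
    ext ω
    simp only [ultrafiltersToInfinity, Set.mem_ofPred_eq, Set.mem_iInter,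
      (hasBasis_cocompact (X := G)).tendsto_right_iff]
    rfl
  rw [this]
  exact isClosed_biInter fun K _ => ultrafilter_isClosed_basic _

/-- The extension to `βΓ` of the inner automorphism `x ↦ γ x γ⁻¹`. -/
def adUltrafilter (γ : Γ) : Ultrafilter Γ → Ultrafilter Γ :=
  Ultrafilter.map fun x => γ * x * γ⁻¹

theorem continuous_adUltrafilter (γ : Γ) : Continuous (adUltrafilter γ) := by
  refine ultrafilterBasis_is_basis.continuous_iff.2 ?_
  rintro _ ⟨s, rfl⟩
  exact ultrafilter_isOpen_basic ((fun x => γ * x * γ⁻¹) ⁻¹' s)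

end Ultrafilters

section Boundary

variable {G Γ : Type*} [Group G] [TopologicalSpace G] [IsTopologicalGroup G] [Group Γ] (p : Γ →* G)

theorem adUltrafilter_mem_ultrafiltersToInfinity (γ : Γ) {ω : Ultrafilter Γ} :
    adUltrafilter γ ω ∈ ultrafiltersToInfinity p ↔ ω ∈ ultrafiltersToInfinity p := by
  let e : G ≃ₜ G := (Homeomorph.mulLeft (p γ)).trans (Homeomorph.mulRight (p γ)⁻¹)
  have he : p ∘ (fun x => γ * x * γ⁻¹) = e ∘ p := by
    ext x
    simp [e]
  change Tendsto p (Filter.map _ _) _ ↔ Tendsto p ω _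
  rw [tendsto_map'_iff, he]
  refine ⟨fun h => ?_, fun h => e.isClosedEmbedding.tendsto_cocompact.comp h⟩
  refine (e.symm.isClosedEmbedding.tendsto_cocompact.comp h).congr fun x => ?_
  simp

/-- The continuous extension `βΓ → h^u G` of `p : Γ → G`. -/
def ultrafilterLimit : Ultrafilter Γ → SmallAtInfinityCompactification G :=
  Ultrafilter.extend fun γ => evalCharacter (p γ)

theorem continuous_ultrafilterLimit : Continuous (ultrafilterLimit p) :=
  continuous_ultrafilter_extend _

theorem tendsto_ultrafilterLimit_apply (ω : Ultrafilter Γ) (f : smallAtInfinityAlgebra G) :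
    Tendsto (fun x => (f : G →ᵇ ℂ) (p x)) ω (𝓝 (ultrafilterLimit p ω f)) := by
  have h : Tendsto (fun γ => evalCharacter (p γ)) ω (𝓝 (ultrafilterLimit p ω)) :=
    ultrafilter_extend_eq_iff.1 rfl
  have hc : Continuous fun χ : SmallAtInfinityCompactification G => χ f :=
    (WeakDual.eval_continuous f).comp continuous_subtype_val
  exact (hc.tendsto _).comp h

variable {p}

theorem ultrafilterLimit_mem_boundary [LocallyCompactSpace G] {ω : Ultrafilter Γ}
    (hω : ω ∈ ultrafiltersToInfinity p) :
    ultrafilterLimit p ω ∈ smallAtInfinityBoundary G := by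
  intro x hx
  obtain ⟨f, hf, hfx, hf0⟩ := exists_mem_smallAtInfinityAlgebra_apply_ne_zero x
  refine hfx (tendsto_nhds_unique ?_ (hf0.comp hω))
  have := tendsto_ultrafilterLimit_apply p ω ⟨f, hf⟩
  rwa [hx] at this

/-- At infinity, conjugation is left translation: right translations act trivially on
`C(h^u G) / C_0(G)`. -/
theorem ultrafilterLimit_adUltrafilter (γ : Γ) {ω : Ultrafilter Γ}
    (hω : ω ∈ ultrafiltersToInfinity p) :
    ultrafilterLimit p (adUltrafilter γ ω) = p γ • ultrafilterLimit p ω := by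
  refine WeakDual.CharacterSpace.ext fun f => ?_
  rw [smul_character_apply]
  have h1 : Tendsto (fun x => (f : G →ᵇ ℂ) (p (γ * x * γ⁻¹))) ω
      (𝓝 (ultrafilterLimit p (adUltrafilter γ ω) f)) :=
    (tendsto_ultrafilterLimit_apply p (adUltrafilter γ ω) f).comp tendsto_map
  have h2 := tendsto_ultrafilterLimit_apply p ω (leftTranslateCLM (p γ)⁻¹ f)
  have h3 := (f.2.2 (p γ)⁻¹).comp
    ((Homeomorph.mulLeft (p γ)).isClosedEmbedding.tendsto_cocompact.comp hω)
  have h4 := h2.add h3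
  rw [add_zero] at h4
  refine tendsto_nhds_unique h1 (h4.congr fun x => ?_)
  change (f : G →ᵇ ℂ) ((p γ)⁻¹⁻¹ * p x) + ((f : G →ᵇ ℂ) (p γ * p x * (p γ)⁻¹) -
    (f : G →ᵇ ℂ) (p γ * p x)) = _
  simp

end Boundary

/-! ### Almost invariant measures from invariant measures at infinity -/

/-- The topological amenability of the boundary action turns an `Ad(Γ)`-invariant measure that
charges the ultrafilters going to infinity in `G` into probability measures on `G` that are almost
invariant under `p(Γ)`, uniformly on compact sets. -/
theorem exists_almost_invariant_of_isBiExact {G Γ : Type*} [Group G] [TopologicalSpace G]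
    [IsTopologicalGroup G] [LocallyCompactSpace G] [SecondCountableTopology G] [T2Space G]
    [MeasurableSpace G] [BorelSpace G] [Group Γ] (hG : IsBiExact G) (p : Γ →* G)
    (μ : Measure (Ultrafilter Γ)) [IsProbabilityMeasure μ]
    (hμ : ∀ γ : Γ, μ.map (adUltrafilter γ) = μ) (hX : μ (ultrafiltersToInfinity p) ≠ 0)
    {ε : ℝ} (hε : 0 < ε) {K : Set G} (hK : IsCompact K) :
    ∃ ν : Measure G, IsProbabilityMeasure ν ∧ ∀ γ : Γ, p γ ∈ K → ∀ A : Set G, MeasurableSet A →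
      |(ν.map fun x => p γ * x).real A - ν.real A| ≤ ε := by
  let _ : MetricSpace G := TopologicalSpace.metrizableSpaceMetric G
  set X := ultrafiltersToInfinity p
  have hXm : MeasurableSet X := (isClosed_ultrafiltersToInfinity p).measurableSet
  have : CompactSpace X :=
    isCompact_iff_compactSpace.1 (isClosed_ultrafiltersToInfinity p).isCompact
  -- the equivariant boundary map and the induced action on `X`
  let φ : X → smallAtInfinityBoundary G := fun ω =>
    ⟨ultrafilterLimit p ω, ultrafilterLimit_mem_boundary ω.2⟩
  have hφ : Continuous φ :=
    ((continuous_ultrafilterLimit p).comp continuous_subtype_val).subtype_mk _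
  let T : Γ → X → X := fun γ ω =>
    ⟨adUltrafilter γ ω, (adUltrafilter_mem_ultrafiltersToInfinity p γ).2 ω.2⟩
  have hT : ∀ γ, Continuous (T γ) := fun γ =>
    ((continuous_adUltrafilter γ).comp continuous_subtype_val).subtype_mk _
  have hφT : ∀ γ ω, φ (T γ ω) = p γ • φ ω := fun γ ω =>
    Subtype.ext (ultrafilterLimit_adUltrafilter γ ω.2)
  obtain ⟨m, hm, hmε⟩ := hG ε hε K hK (Set.range φ) (isCompact_range hφ)
  let κ : X → Measure G := fun ω => (m (φ ω) : Measure G)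
  have hκ : Measurable κ := measurable_coe_of_continuous_probabilityMeasure (hm.comp hφ)
  have hκp : ∀ ω, IsProbabilityMeasure (κ ω) := fun ω => inferInstanceAs
    (IsProbabilityMeasure (m (φ ω) : Measure G))
  -- `μ` conditioned to `X`
  let ν : Measure X := (μ X)⁻¹ • μ.comap Subtype.val
  have hcomap : ∀ s : Set X, μ.comap Subtype.val s = μ (Subtype.val '' s) := fun s =>
    (MeasurableEmbedding.subtype_coe hXm).comap_apply μ s
  have hν : IsProbabilityMeasure ν := ⟨by
    rw [Measure.smul_apply, hcomap, Set.image_univ, Subtype.range_coe, smul_eq_mul]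
    exact ENNReal.inv_mul_cancel hX (measure_ne_top _ _)⟩
  have hTν : ∀ γ, MeasurePreserving (T γ) ν ν := by
    intro γ
    refine ⟨(hT γ).measurable, ?_⟩
    rw [Measure.map_smul]
    congr 1
    ext s hs
    rw [Measure.map_apply (hT γ).measurable hs, hcomap, hcomap]
    have hs' : MeasurableSet (Subtype.val '' s : Set (Ultrafilter Γ)) := hXm.subtype_image hs
    nth_rewrite 2 [← hμ γ]
    rw [Measure.map_apply (continuous_adUltrafilter γ).measurable hs']
    congr 1
    ext ω
    constructor
    · rintro ⟨ω, hω, rfl⟩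
      exact ⟨_, hω, rfl⟩
    · rintro ⟨ω', hω', he⟩
      have hω : ω ∈ X := (adUltrafilter_mem_ultrafiltersToInfinity p γ).1 (he ▸ ω'.2)
      refine ⟨⟨ω, hω⟩, ?_, rfl⟩
      have : T γ ⟨ω, hω⟩ = ω' := Subtype.ext he.symm
      rwa [Set.mem_preimage, this]
  refine ⟨ν.bind κ, ?_, fun γ hγ A hA => ?_⟩
  · refine ⟨?_⟩
    rw [Measure.bind_apply MeasurableSet.univ hκ.aemeasurable]
    simp
  · refine abs_measureReal_map_bind_sub_le hκ (hTν γ) (by fun_prop) (fun ω B hB => ?_) hA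
    have := hmε (p γ) hγ (φ ω) ⟨ω, rfl⟩ B hB
    rwa [← hφT] at this

/-- Almost invariance under a dense set `D`, uniformly on compact sets, passes to the whole group,
as `g ↦ ∫ f (g x) dν(x)` is continuous. -/
theorem isAmenableGroup_of_dense {G : Type*} [Group G] [TopologicalSpace G] [IsTopologicalGroup G]
    [LocallyCompactSpace G] [SecondCountableTopology G] [MeasurableSpace G] [BorelSpace G]
    {D : Set G} (hD : Dense D)
    (h : ∀ ε : ℝ, 0 < ε → ∀ K : Set G, IsCompact K → ∃ ν : Measure G, IsProbabilityMeasure ν ∧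
      ∀ g ∈ D, g ∈ K → ∀ A : Set G, MeasurableSet A →
        |(ν.map fun x => g * x).real A - ν.real A| ≤ ε) :
    IsAmenableGroup G := by
  refine isAmenableGroup_of_almost_invariant fun ε hε F => ?_
  -- `K` is a neighbourhood of each `g ∈ F`, so that `g` is a limit of elements of `D ∩ K`
  obtain ⟨K, hK, hFK⟩ := exists_compact_superset F.finite_toSet.isCompact
  obtain ⟨ν, hν, hνε⟩ := h (ε / 2) (half_pos hε) K hK
  refine ⟨ν, hν, fun g hg f => ?_⟩
  have hcont : Continuous fun g : G => |∫ x, f (g * x) ∂ν - ∫ x, f x ∂ν| := by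
    refine ((continuous_of_dominated (F := fun g x => f (g * x)) (bound := fun _ => ‖f‖)
      (fun g => ?_) (fun g => Eventually.of_forall fun x => f.norm_coe_le_norm _)
      (integrable_const _) (Eventually.of_forall fun x => ?_)).sub continuous_const).abs
    · exact (f.continuous.comp (continuous_const_mul g)).measurable.aestronglyMeasurable
    · exact f.continuous.comp (continuous_mul_const x)
  have hcl : closure (interior K ∩ D) ⊆ {g | |∫ x, f (g * x) ∂ν - ∫ x, f x ∂ν| ≤ ε * ‖f‖} := by
    refine closure_minimal (fun k hk => ?_) (isClosed_le hcont continuous_const)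
    have hmk : Measurable fun x : G => k * x := by fun_prop
    have : IsProbabilityMeasure (ν.map fun x => k * x) :=
      Measure.isProbabilityMeasure_map hmk.aemeasurable
    have := abs_integral_sub_le_of_abs_measureReal_sub_le
      (hνε k hk.2 (interior_subset hk.1)) f.continuous.measurable f.norm_coe_le_norm
    rw [integral_map hmk.aemeasurable f.continuous.measurable.aestronglyMeasurable] at this
    exact this.trans_eq (by ring)
  exact hcl (hD.open_subset_closure_inter isOpen_interior (hFK hg))

/-- A discrete subgroup under which probability measures on the ambient group are almost invariant
is amenable: the measures are pushed to `Λ` by an equivariant Borel map. -/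
theorem isAmenableGroup_of_discrete {G : Type*} [Group G] [TopologicalSpace G]
    [IsTopologicalGroup G] [SecondCountableTopology G] [MeasurableSpace G] [BorelSpace G]
    (Λ : Subgroup G) [DiscreteTopology Λ]
    (h : ∀ ε : ℝ, 0 < ε → ∀ K : Set G, IsCompact K → ∃ ν : Measure G, IsProbabilityMeasure ν ∧
      ∀ g ∈ Λ, g ∈ K → ∀ A : Set G, MeasurableSet A →
        |(ν.map fun x => g * x).real A - ν.real A| ≤ ε) :
    IsAmenableGroup Λ := by
  obtain ⟨c, hc, hceq⟩ := exists_measurable_equivariant_of_discrete Λ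
  refine isAmenableGroup_of_almost_invariant fun ε hε F => ?_
  obtain ⟨ν, hν, hνε⟩ := h (ε / 2) (half_pos hε) _
    ((F.finite_toSet.image ((↑) : Λ → G)).isCompact)
  have := Measure.isProbabilityMeasure_map (μ := ν) hc.aemeasurable
  refine ⟨ν.map c, this, fun l hl f => ?_⟩
  have hml : Measurable fun x : Λ => l * x := (continuous_const_mul l).measurable
  have hmg : Measurable fun x : G => (l : G) * x := by fun_prop
  have hlp : IsProbabilityMeasure ((ν.map c).map fun x => l * x) :=
    Measure.isProbabilityMeasure_map hml.aemeasurable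
  have hcomm : (ν.map c).map (fun x => l * x) = (ν.map fun x => (l : G) * x).map c := by
    rw [Measure.map_map hml hc, Measure.map_map hc hmg]
    congr 1
    ext1 x
    exact (hceq l x).symm
  have key := abs_integral_sub_le_of_abs_measureReal_sub_le
    (μ := (ν.map c).map fun x => l * x) (ν := ν.map c) (ε := ε / 2) (fun A hA => by
      rw [hcomm, map_measureReal_apply hc hA, map_measureReal_apply hc hA]
      exact hνε l l.2 ⟨l, hl, rfl⟩ _ (hc hA)) f.continuous.measurable f.norm_coe_le_norm
  rw [integral_map hml.aemeasurable f.continuous.measurable.aestronglyMeasurable] at key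
  exact key.trans_eq (by ring)

/-! ### Conjugation invariant measures on the Stone-Čech compactification -/

/-- A finite `Ad`-invariant measure does not charge points with infinitely many conjugates. -/
theorem measure_singleton_pure_eq_zero {Γ : Type*} [Group Γ] {μ : Measure (Ultrafilter Γ)}
    [IsFiniteMeasure μ] (hμ : ∀ γ : Γ, μ.map (adUltrafilter γ) = μ) {x : Γ}
    (hx : (conjugatesOf x).Infinite) : μ {(pure x : Ultrafilter Γ)} = 0 := by
  by_contra h0
  have hmeas : ∀ y : Γ, MeasurableSet {(pure y : Ultrafilter Γ)} := fun y =>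
    measurableSet_singleton _
  have hconj : ∀ y ∈ conjugatesOf x,
      μ {(pure x : Ultrafilter Γ)} ≤ μ {(pure y : Ultrafilter Γ)} := by
    intro y hy
    obtain ⟨γ, rfl⟩ := isConj_iff.1 (show IsConj x y from hy)
    nth_rewrite 2 [← hμ γ]
    rw [Measure.map_apply (continuous_adUltrafilter γ).measurable (hmeas _)]
    refine measure_mono ?_
    rintro _ rfl
    exact Ultrafilter.map_pure _ _
  have hfin := Measure.finite_const_le_meas_of_disjoint_iUnion μ (pos_iff_ne_zero.2 h0) hmeas
    (fun y z hyz => Set.disjoint_singleton.2 fun h => hyz (Ultrafilter.pure_injective h))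
    (measure_ne_top _ _)
  exact hx (hfin.subset hconj)

/-- A nonprincipal ultrafilter on a discrete subgroup of a finite product tends to infinity in one
of the factors. -/
theorem exists_mem_ultrafiltersToInfinity {ι : Type*} [Finite ι] {G : ι → Type*}
    [∀ i, Group (G i)] [∀ i, TopologicalSpace (G i)] [∀ i, IsTopologicalGroup (G i)]
    [∀ i, T2Space (G i)] (Γ : Subgroup (∀ i, G i)) [DiscreteTopology Γ] {ω : Ultrafilter Γ}
    (hω : ∀ x : Γ, ω ≠ pure x) :
    ∃ i, ω ∈ ultrafiltersToInfinity ((Pi.evalMonoidHom G i).comp Γ.subtype) := by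
  -- otherwise `ω` contains the trace on `Γ` of a compact box, which is finite
  by_contra! hcon
  have hK : ∀ i, ∃ K : Set (G i), IsCompact K ∧ {x : Γ | (x : ∀ i, G i) i ∈ K} ∈ ω := by
    intro i
    have := hcon i
    simp only [ultrafiltersToInfinity, Set.mem_ofPred_eq,
      (hasBasis_cocompact (X := G i)).tendsto_right_iff, not_forall] at this
    obtain ⟨K, hK, hKω⟩ := this
    refine ⟨K, hK, ?_⟩
    rw [← Ultrafilter.eventually_not] at hKω
    exact hKω.mono fun x hx => not_not.1 hx
  choose K hK hKω using hK
  have hmem : {x : Γ | (x : ∀ i, G i) ∈ Set.univ.pi K} ∈ ω := by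
    have := (eventually_all (l := (ω : Filter Γ))).2 hKω
    exact this.mono fun x hx i _ => hx i
  have hfin : {x : Γ | (x : ∀ i, G i) ∈ Set.univ.pi K}.Finite := by
    have := Γ.tendsto_coe_cofinite_of_discrete ⟨inferInstance⟩
      (isCompact_univ_pi hK).compl_mem_cocompact
    rw [mem_map, mem_cofinite] at this
    refine this.subset fun x hx h => h hx
  obtain ⟨x, -, hx⟩ := Ultrafilter.eq_pure_of_finite_mem hfin hmem
  exact hω x hx

theorem mainTheorem2 {n : ℕ} (G : Fin n → Type*)
    [∀ i, Group (G i)] [∀ i, TopologicalSpace (G i)] [∀ i, IsTopologicalGroup (G i)]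
    [∀ i, LocallyCompactSpace (G i)] [∀ i, SecondCountableTopology (G i)] [∀ i, T2Space (G i)]
    [∀ i, MeasurableSpace (G i)] [∀ i, BorelSpace (G i)]
    (hnonamen : ∀ i, ¬ IsAmenableGroup (G i)) (hbiexact : ∀ i, IsBiExact (G i))
    (Γ : Subgroup (∀ i, G i)) (hdiscrete : DiscreteTopology Γ) (hicc : IsICCGroup Γ)
    (hproj :
      (∀ i, ∃ Λ : Subgroup (G i), Λ ≤ Γ.map (Pi.evalMonoidHom G i) ∧
        DiscreteTopology Λ ∧ ¬ IsAmenableGroup Λ) ∨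
      (∀ i, Dense (Γ.map (Pi.evalMonoidHom G i) : Set (G i)))) :
    ¬ IsInnerAmenable Γ := by
  rintro ⟨μ, hμ, -, hμ1, hinv⟩
  replace hinv : ∀ γ : Γ, μ.map (adUltrafilter γ) = μ := hinv
  have : Countable Γ := TopologicalSpace.separableSpace_iff_countable.1 inferInstance
  have hpure : μ (⋃ x : Γ, {(pure x : Ultrafilter Γ)}) = 0 := by
    refine measure_iUnion_null fun x => ?_
    by_cases hx : x = 1
    · rw [hx, hμ1]
    · exact measure_singleton_pure_eq_zero hinv (hicc x hx)
  -- some factor carries mass at infinity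
  obtain ⟨i, hi⟩ : ∃ i, μ (ultrafiltersToInfinity ((Pi.evalMonoidHom G i).comp Γ.subtype)) ≠ 0 := by
    by_contra! h0
    have huniv : (Set.univ : Set (Ultrafilter Γ)) ⊆ (⋃ x : Γ, {(pure x : Ultrafilter Γ)}) ∪
        ⋃ i, ultrafiltersToInfinity ((Pi.evalMonoidHom G i).comp Γ.subtype) := by
      intro ω _
      by_cases hω : ∃ x : Γ, ω = pure x
      · exact Or.inl (Set.mem_iUnion.2 hω)
      · exact Or.inr (Set.mem_iUnion.2
          (exists_mem_ultrafiltersToInfinity Γ (not_exists.1 hω)))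
    have h1 := measure_mono_null huniv (measure_union_null hpure (measure_iUnion_null h0))
    rw [measure_univ] at h1
    exact one_ne_zero h1
  have hai : ∀ ε : ℝ, 0 < ε → ∀ K : Set (G i), IsCompact K →
      ∃ ν : Measure (G i), IsProbabilityMeasure ν ∧ ∀ g ∈ Γ.map (Pi.evalMonoidHom G i), g ∈ K →
        ∀ A : Set (G i), MeasurableSet A →
          |(ν.map fun x => g * x).real A - ν.real A| ≤ ε := by
    intro ε hε K hK
    obtain ⟨ν, hν, h⟩ := exists_almost_invariant_of_isBiExact (hbiexact i) _ μ hinv hi hε hK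
    refine ⟨ν, hν, ?_⟩
    rintro _ ⟨γ, hγ, rfl⟩ hgK
    exact h ⟨γ, hγ⟩ hgK
  rcases hproj with hdisc | hdense
  · obtain ⟨Λ, hΛ, hΛd, hΛn⟩ := hdisc i
    refine hΛn (isAmenableGroup_of_discrete Λ fun ε hε K hK => ?_)
    obtain ⟨ν, hν, h⟩ := hai ε hε K hK
    exact ⟨ν, hν, fun g hg => h g (hΛ hg)⟩
  · exact hnonamen i (isAmenableGroup_of_dense (hdense i) hai)

end
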